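/- **Regexes and states.** JavaScript regexes are built from $\varepsilon$, character descriptors, disjunction $r_1|r_2$, sequence $r_1r_2$, capture groups $(_g\,r)$, backreferences, anchors, the four (positive/negative) lookaheads and lookbehinds, and greedy or lazy quantifiers $r\{min,\Delta\}$ (between $min$ and $min+\Delta$ repetitions, $\Delta\in\mathbb N\cup\{\infty\}$). A quantifier is *lower-bounded* if $min>0$. For regexes without lower-bounded quantifiers the size is $|\varepsilon|=|\text{character}|=|\text{anchor}|=|\text{backreference}|=1$, $|r_1|r_2|=|r_1r_2|=1+|r_1|+|r_2|$, $|r\{0,\Delta\}|=3+|r|$, $|\text{lookaround of }r|=1+|r|$, $|(_g\,r)|=2+|r|$. An *input* $i$ is a string $\mathrm{str}(i)$ with a position in it; $|i|_d$ is the length remaining in direction $d\in\{\rightarrow,\leftarrow\}$, and $i<_d i'$ means that $i,i'$ have the same string and the position of $i$ is strictly further in direction $d$. An *action* is a regex $r$ to be matched, $\mathsf{Close}(g)$, or $\mathsf{Check}(i)$; $|\mathsf{Close}(g)|=1$. A *semantic state* $(l,i,gm,d)$ consists of a list of actions, an input, a group map and a direction. **Functional semantics.** The functional semantics computes the backtracking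 tree of a state recursively. The *next states* of $s=(l,i,gm,d)$ are the states on which it makes a recursive call at $s$; there is none for $l=[\,]$, and otherwise, according to the first action, with $k$ the remaining actions: - $\mathsf{Check}(i')$: if $i<_d i'$, $(k,i,gm,d)$. - $\mathsf{Close}(g)$: $(k,i,gm',d)$ with $g$ closed at $i$ in $gm'$. - $\varepsilon$, or an anchor that holds at $i$: $(k,i,gm,d)$. - A character descriptor or a backreference that can be read at $i$ in direction $d$: $(k,i',gm,d)$, where $i'$ is the input after reading. - $r_1|r_2$: $(r_1::k,i,gm,d)$ and $(r_2::k,i,gm,d)$. - $r_1r_2$: $(r_1::r_2::k,i,gm,d)$ if $d=\rightarrow$, and $(r_2::r_1::k,i,gm,d)$ if $d=\leftarrow$. - $(_g\,r)$: $(r::\mathsf{Close}(g)::k,i,gm',d)$ with $g$ opened at $i$ in $gm'$. - $r\{min+1,\Delta\}$: $(r::r\{min,\Delta\}::k,i,gm',d)$ with the groups of $r$ reset in $gm'$. - $r\{0,\Delta\}$: $(k,i,gm,d)$ and, if $\Delta\ne0$, $(r::\mathsf{Check}(i)::r\{0,\Delta-1\}::k,i,gm',d)$ with the groups of $r$ reset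 in $gm'$. - A lookaround over $r$, of direction $d'$: $([r],i,gm,d')$ and, if the lookaround succeeds, $(k,i,gm',d)$, where $gm'$ is the group map of the first match of $r$ for a positive lookaround and $gm'=gm$ for a negative one. A state is *reachable* from a regex $r$ if it is obtained by finitely many (possibly zero) passages to a next state from a state $([r],i,gm,d)$ with any input $i$, group map $gm$ and direction $d$. **Fuel.** For a list of actions $l=c_1\mathbin{+\!\!+}\mathsf{Check}(i_1)::c_2\mathbin{+\!\!+}\cdots\mathbin{+\!\!+}\mathsf{Check}(i_{n-1})::c_n$, where the *chunks* $c_k$ contain no check, let $p=\mathrm{prog}(l,i,d)$ be $1$ if $i<_d i'$ for all $\mathsf{Check}(i')\in l$, and $0$ otherwise. For a check-free list $c=[a_1;\dots;a_m]$ put - $\mathrm{fuel\_first}(c,p)=1+\sum_{k=2}^m|a_k|$ if $a_1$ is a non-lower-bounded quantifier and $p=1$, and $\sum_{k=1}^m|a_k|$ otherwise, - $\mathrm{fuel\_middle}(c)=1+\sum_{k=2}^m|a_k|$, - $\mathrm{fuel\_last}(c,i,d,p)=\big(\sum_{k=1}^m|a_k|\big)(|i|_d+p)$. Lookaround fuel: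 $\mathrm{reg\_lk\_fuel}(s,\cdot)$ is $0$ on $\varepsilon$, characters, anchors and backreferences, has the value of the sub-regex on groups and quantifiers, is the maximum over both sub-regexes on disjunctions and sequences, and is $(1+|s|)\,|r|+\mathrm{reg\_lk\_fuel}(s,r)$ on a lookaround over $r$; $\mathrm{act\_lk\_fuel}(s,l)$ is the maximum of $\mathrm{reg\_lk\_fuel}(s,r)$ over the regex actions $r$ of $l$ ($0$ if there are none). Then $\mathtt{fuel}(l,i,gm,d)$ equals $$\mathrm{fuel\_last}(c_n,i,d,p)+\mathrm{act\_lk\_fuel}(\mathrm{str}(i),l)$$ if $n=1$ (no checks), and $$\big(\mathrm{fuel\_first}(c_1,p)+1\big)+\sum_{k=2}^{n-1}\big(\mathrm{fuel\_middle}(c_k)+1\big)+\mathrm{fuel\_last}(c_n,i,d,p)+\mathrm{act\_lk\_fuel}(\mathrm{str}(i),l)$$ if $n\ge2$. **Theorem (fuel decrease).** Let $r$ be a JavaScript regex without lower-bounded quantifiers. For all semantic states $s_1,s_2$ such that $s_1$ is reachable from $r$ and $s_2$ is one of the next states of $s_1$, we have $\mathtt{fuel}(s_2)<\mathtt{fuel}(s_1)$.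 -/

import Mathlib

namespace JSRegex

/-! ## Characters and inputs -/

/-- Characters are given by their numeric value (UTF-16 code units or Unicode code points). -/
abbrev Character : Type := Fin 0x110000

/-- Matching direction: `forward` is left to right, `backward` is right to left. -/
inductive Direction where
  | forward
  | backward

/-- An input is a string together with a position in it. `behind` is the part of the string before
the position, in reverse order (nearest character first), `ahead` is the part after it. -/
structure Input where
  behind : List Character
  ahead : List Character

/-- The whole string of an input. -/
def Input.str (i : Input) : List Character := i.behind.reverse ++ i.ahead

/-- The position of an input in its string. -/
def Input.idx (i : Input) : ℕ := i.behind.length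

/-- The remaining length `|i|_d` of the input in direction `d`. -/
def Input.remaining (i : Input) : Direction → ℕ
  | .forward => i.ahead.length
  | .backward => i.behind.length

/-- `i <_d i'`: same string, and the position of `i` is strictly further in direction `d`. -/
def Input.Lt (d : Direction) (i i' : Input) : Prop :=
  i.str = i'.str ∧
    match d with
    | .forward => i'.idx < i.idx
    | .backward => i.idx < i'.idx

/-- Moving by one character in direction `d` (no move at the end of the string). -/
def Input.advance (d : Direction) (i : Input) : Input :=
  match d, i with
  | .forward, ⟨b, c :: a⟩ => ⟨c :: b, a⟩
  | .backward, ⟨c :: b, a⟩ => ⟨b, c :: a⟩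
  | _, i => i

/-- Moving by `n` characters in direction `d`. -/
def Input.advanceN (d : Direction) (n : ℕ) (i : Input) : Input := (Input.advance d)^[n] i

/-! ## Regexes -/

/-- Character descriptors. A Unicode property is represented by the set of its characters. -/
inductive CharDescr where
  | empty
  | dot
  | all
  | single (c : Character)
  | digit
  | nonDigit
  | whitespace
  | nonWhitespace
  | wordChar
  | nonWordChar
  | unicodeProp (p : Set Character)
  | nonUnicodeProp (p : Set Character)
  | range (lo hi : Character)
  | union (cd₁ cd₂ : CharDescr)
  | inv (cd : CharDescr)

/-- The anchors `^`, `$`, `\b` and `\B`. -/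
inductive Anchor where
  | beginInput
  | endInput
  | wordBoundary
  | nonWordBoundary

/-- The four kinds of lookarounds. -/
inductive Lookaround where
  | lookahead
  | lookbehind
  | negLookahead
  | negLookbehind

def Lookaround.dir : Lookaround → Direction
  | .lookahead => .forward
  | .negLookahead => .forward
  | .lookbehind => .backward
  | .negLookbehind => .backward

def Lookaround.positive : Lookaround → Bool
  | .lookahead => true
  | .lookbehind => true
  | .negLookahead => false
  | .negLookbehind => false

/-- JavaScript regexes. `quantified greedy min Δ r` repeats `r` at least `min` and at most `min + Δ`
times, with `Δ` possibly infinite; the star is `quantified true 0 ⊤ r`. Capture groups are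
annotated with their index. -/
inductive Regex where
  | epsilon
  | character (cd : CharDescr)
  | disjunction (r₁ r₂ : Regex)
  | sequence (r₁ r₂ : Regex)
  | quantified (greedy : Bool) (min : ℕ) (Δ : ℕ∞) (r : Regex)
  | lookaround (lk : Lookaround) (r : Regex)
  | group (g : ℕ) (r : Regex)
  | anchor (a : Anchor)
  | backreference (g : ℕ)

/-- No quantifier of the regex is lower-bounded: all minimum numbers of repetitions are zero. -/
def Regex.NoLowerBound : Regex → Prop
  | .epsilon => True
  | .character _ => True
  | .disjunction r₁ r₂ => r₁.NoLowerBound ∧ r₂.NoLowerBound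
  | .sequence r₁ r₂ => r₁.NoLowerBound ∧ r₂.NoLowerBound
  | .quantified _ min _ r => min = 0 ∧ r.NoLowerBound
  | .lookaround _ r => r.NoLowerBound
  | .group _ r => r.NoLowerBound
  | .anchor _ => True
  | .backreference _ => True

/-- The size `|r|` of a regex (for regexes without lower-bounded quantifiers). -/
def Regex.size : Regex → ℕ
  | .epsilon => 1
  | .character _ => 1
  | .disjunction r₁ r₂ => 1 + r₁.size + r₂.size
  | .sequence r₁ r₂ => 1 + r₁.size + r₂.size
  | .quantified _ _ _ r => 3 + r.size
  | .lookaround _ r => 1 + r.size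
  | .group _ r => 2 + r.size
  | .anchor _ => 1
  | .backreference _ => 1

/-- The capture groups defined in a regex. -/
def Regex.defGroups : Regex → List ℕ
  | .epsilon => []
  | .character _ => []
  | .disjunction r₁ r₂ => r₁.defGroups ++ r₂.defGroups
  | .sequence r₁ r₂ => r₁.defGroups ++ r₂.defGroups
  | .quantified _ _ _ r => r.defGroups
  | .lookaround _ r => r.defGroups
  | .group g r => g :: r.defGroups
  | .anchor _ => []
  | .backreference _ => []

/-! ## Reading characters, anchors -/

/-- The flags of a JavaScript regex that influence matching (`i`, `m`, `s`, `u`). -/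
structure Flags where
  ignoreCase : Bool
  multiline : Bool
  dotAll : Bool
  unicode : Bool

/-- The case mapping of the Unicode Character Database that is used for case-insensitive matching:
simple case folding in Unicode mode (argument `true`), upper-casing otherwise. -/
abbrev CaseMap : Type := Bool → Character → Character

def canonicalize (cm : CaseMap) (fl : Flags) (c : Character) : Character :=
  if fl.ignoreCase then cm fl.unicode c else c

def IsLineTerminator (c : Character) : Prop :=
  c.val = 0x0A ∨ c.val = 0x0D ∨ c.val = 0x2028 ∨ c.val = 0x2029

def IsDigit (c : Character) : Prop := 0x30 ≤ c.val ∧ c.val ≤ 0x39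

def IsWhitespace (c : Character) : Prop :=
  IsLineTerminator c ∨ c.val = 0x09 ∨ c.val = 0x0B ∨ c.val = 0x0C ∨ c.val = 0x20 ∨ c.val = 0xA0 ∨
    c.val = 0x1680 ∨ (0x2000 ≤ c.val ∧ c.val ≤ 0x200A) ∨ c.val = 0x202F ∨ c.val = 0x205F ∨
    c.val = 0x3000 ∨ c.val = 0xFEFF

/-- ASCII letters, digits and underscore. -/
def IsBasicWordChar (c : Character) : Prop :=
  IsDigit c ∨ (0x41 ≤ c.val ∧ c.val ≤ 0x5A) ∨ (0x61 ≤ c.val ∧ c.val ≤ 0x7A) ∨ c.val = 0x5F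

def IsWordChar (cm : CaseMap) (fl : Flags) (c : Character) : Prop :=
  IsBasicWordChar c ∨ IsBasicWordChar (canonicalize cm fl c)

/-- `c` is, up to canonicalization, a member of the set of characters `A`. -/
def CanonMem (cm : CaseMap) (fl : Flags) (A : Set Character) (c : Character) : Prop :=
  ∃ a ∈ A, canonicalize cm fl a = canonicalize cm fl c

/-- The character `c` matches a character descriptor. -/
def CharMatch (cm : CaseMap) (fl : Flags) (c : Character) : CharDescr → Prop
  | .empty => False
  | .dot => CanonMem cm fl {a | fl.dotAll = true ∨ ¬ IsLineTerminator a} c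
  | .all => True
  | .single a => CanonMem cm fl {a} c
  | .digit => CanonMem cm fl {a | IsDigit a} c
  | .nonDigit => CanonMem cm fl {a | ¬ IsDigit a} c
  | .whitespace => CanonMem cm fl {a | IsWhitespace a} c
  | .nonWhitespace => CanonMem cm fl {a | ¬ IsWhitespace a} c
  | .wordChar => CanonMem cm fl {a | IsWordChar cm fl a} c
  | .nonWordChar => CanonMem cm fl {a | ¬ IsWordChar cm fl a} c
  | .unicodeProp p => CanonMem cm fl p c
  | .nonUnicodeProp p => CanonMem cm fl pᶜ c
  | .range lo hi => CanonMem cm fl (Set.Icc lo hi) c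
  | .union cd₁ cd₂ => CharMatch cm fl c cd₁ ∨ CharMatch cm fl c cd₂
  | .inv cd => ¬ CharMatch cm fl c cd

open Classical in
/-- Reading one character that matches the descriptor in direction `d`. -/
noncomputable def readChar (cm : CaseMap) (fl : Flags) (cd : CharDescr) (i : Input)
    (d : Direction) : Option (Character × Input) :=
  match d, i with
  | .forward, ⟨b, c :: a⟩ => if CharMatch cm fl c cd then some (c, ⟨c :: b, a⟩) else none
  | .backward, ⟨c :: b, a⟩ => if CharMatch cm fl c cd then some (c, ⟨b, c :: a⟩) else none
  | _, _ => none

/-- The character right before (resp. after) the current position exists and is a word character. -/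
def WordBefore (cm : CaseMap) (fl : Flags) (i : Input) : Prop :=
  ∃ c ∈ i.behind.head?, IsWordChar cm fl c

def WordAfter (cm : CaseMap) (fl : Flags) (i : Input) : Prop :=
  ∃ c ∈ i.ahead.head?, IsWordChar cm fl c

def AnchorSatisfied (cm : CaseMap) (fl : Flags) (i : Input) : Anchor → Prop
  | .beginInput =>
      i.behind = [] ∨ (fl.multiline = true ∧ ∃ c ∈ i.behind.head?, IsLineTerminator c)
  | .endInput =>
      i.ahead = [] ∨ (fl.multiline = true ∧ ∃ c ∈ i.ahead.head?, IsLineTerminator c)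
  | .wordBoundary => ¬ (WordBefore cm fl i ↔ WordAfter cm fl i)
  | .nonWordBoundary => WordBefore cm fl i ↔ WordAfter cm fl i

/-! ## Group maps -/

/-- A group map assigns to a group nothing, or the index at which it was opened (group still open),
or the two indices that delimit the captured substring (group closed). -/
abbrev GroupMap : Type := ℕ → Option (ℕ × Option ℕ)

def GroupMap.openGroup (idx g : ℕ) (gm : GroupMap) : GroupMap :=
  Function.update gm g (some (idx, none))

def GroupMap.closeGroup (idx g : ℕ) (gm : GroupMap) : GroupMap :=
  match gm g with
  | none => gm
  | some (start, _) => Function.update gm g (some (min start idx, some (max start idx)))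

def GroupMap.reset (gs : List ℕ) (gm : GroupMap) : GroupMap :=
  fun g => if g ∈ gs then none else gm g

/-- Reading a backreference in direction `d`. A group that is not closed matches the empty string.
Returns the string that was read and the new input. -/
def readBackref (cm : CaseMap) (fl : Flags) (gm : GroupMap) (g : ℕ) (i : Input) (d : Direction) :
    Option (List Character × Input) :=
  match gm g with
  | some (start, some fin) =>
      let sub := (i.str.drop start).take (fin - start)
      let read :=
        match d with
        | .forward => i.ahead.take sub.length
        | .backward => (i.behind.take sub.length).reverse
      if read.map (canonicalize cm fl) = sub.map (canonicalize cm fl) then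
        some (read, i.advanceN d sub.length)
      else none
  | _ => some ([], i)

/-! ## Backtracking trees -/

/-- Operations on the group map recorded in a backtracking tree. -/
inductive GroupAction where
  | openGroup (g : ℕ)
  | closeGroup (g : ℕ)
  | reset (gs : List ℕ)

def GroupAction.apply (idx : ℕ) (gm : GroupMap) : GroupAction → GroupMap
  | .openGroup g => gm.openGroup idx g
  | .closeGroup g => gm.closeGroup idx g
  | .reset gs => gm.reset gs

/-- Backtracking trees. -/
inductive Tree where
  | mismatched
  | matched
  | choice (t₁ t₂ : Tree)
  | read (c : Character) (t : Tree)
  | readBackref (s : List Character) (t : Tree)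
  | progress (t : Tree)
  | anchorPass (a : Anchor) (t : Tree)
  | groupAction (a : GroupAction) (t : Tree)
  | lk (lk : Lookaround) (tlk t : Tree)
  | lkFail (lk : Lookaround) (tlk : Tree)

/-- The first (highest priority) leaf of a backtracking tree: the input and group map at the
leftmost `matched` node, if there is one. -/
def Tree.firstLeaf : Tree → GroupMap → Input → Direction → Option (Input × GroupMap)
  | .mismatched, _, _, _ => none
  | .matched, gm, i, _ => some (i, gm)
  | .choice t₁ t₂, gm, i, d => (t₁.firstLeaf gm i d).or (t₂.firstLeaf gm i d)
  | .read _ t, gm, i, d => t.firstLeaf gm (i.advance d) d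
  | .readBackref s t, gm, i, d => t.firstLeaf gm (i.advanceN d s.length) d
  | .progress t, gm, i, d => t.firstLeaf gm i d
  | .anchorPass _ t, gm, i, d => t.firstLeaf gm i d
  | .groupAction a t, gm, i, d => t.firstLeaf (a.apply i.idx gm) i d
  | .lk k tlk t, gm, i, d =>
      match k.positive, tlk.firstLeaf gm i k.dir with
      | true, some (_, gm') => t.firstLeaf gm' i d
      | true, none => none
      | false, some _ => none
      | false, none => t.firstLeaf gm i d
  | .lkFail _ _, _, _, _ => none

/-- The outcome of a lookaround whose regex has the backtracking tree `tlk`: `none` if the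
lookaround fails, and the group map with which matching continues if it succeeds. -/
def lkResult (k : Lookaround) (tlk : Tree) (gm : GroupMap) (i : Input) : Option GroupMap :=
  match k.positive, tlk.firstLeaf gm i k.dir with
  | true, some (_, gm') => some gm'
  | true, none => none
  | false, some _ => none
  | false, none => some gm

/-! ## The functional semantics -/

/-- Actions: matching a regex, checking progress with respect to an input, closing a group. -/
inductive Action where
  | reg (r : Regex)
  | check (i : Input)
  | close (g : ℕ)

/-- The two regexes of a sequence, in the order in which direction `d` matches them. -/
def seqList (r₁ r₂ : Regex) : Direction → List Action
  | .forward => [.reg r₁, .reg r₂]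
  | .backward => [.reg r₂, .reg r₁]

open Classical in
/-- The functional semantics: the backtracking tree of a list of actions, input, group map and
direction. The first argument bounds the number of nested recursive calls, and the result is `none`
if this bound is exceeded ("out of fuel"). -/
noncomputable def computeTree (cm : CaseMap) (fl : Flags) :
    ℕ → List Action → Input → GroupMap → Direction → Option Tree
  | 0, _, _, _, _ => none
  | _ + 1, [], _, _, _ => some .matched
  | f + 1, .check i' :: l, i, gm, d =>
      if Input.Lt d i i' then (computeTree cm fl f l i gm d).map .progress
      else some .mismatched
  | f + 1, .close g :: l, i, gm, d =>
      (computeTree cm fl f l i (gm.closeGroup i.idx g) d).map (.groupAction (.closeGroup g))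
  | f + 1, .reg .epsilon :: l, i, gm, d => computeTree cm fl f l i gm d
  | f + 1, .reg (.character cd) :: l, i, gm, d =>
      match readChar cm fl cd i d with
      | some (c, i') => (computeTree cm fl f l i' gm d).map (.read c)
      | none => some .mismatched
  | f + 1, .reg (.disjunction r₁ r₂) :: l, i, gm, d =>
      match computeTree cm fl f (.reg r₁ :: l) i gm d, computeTree cm fl f (.reg r₂ :: l) i gm d with
      | some t₁, some t₂ => some (.choice t₁ t₂)
      | _, _ => none
  | f + 1, .reg (.sequence r₁ r₂) :: l, i, gm, d =>
      computeTree cm fl f (seqList r₁ r₂ d ++ l) i gm d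
  | f + 1, .reg (.quantified greedy (min + 1) Δ r) :: l, i, gm, d =>
      (computeTree cm fl f (.reg r :: .reg (.quantified greedy min Δ r) :: l) i
        (gm.reset r.defGroups) d).map (.groupAction (.reset r.defGroups))
  | f + 1, .reg (.quantified greedy 0 Δ r) :: l, i, gm, d =>
      if Δ = 0 then computeTree cm fl f l i gm d
      else
        match computeTree cm fl f (.reg r :: .check i :: .reg (.quantified greedy 0 (Δ - 1) r) :: l)
            i (gm.reset r.defGroups) d,
          computeTree cm fl f l i gm d with
        | some tIter, some tSkip =>
            if greedy then some (.choice (.groupAction (.reset r.defGroups) tIter) tSkip)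
            else some (.choice tSkip (.groupAction (.reset r.defGroups) tIter))
        | _, _ => none
  | f + 1, .reg (.lookaround k r) :: l, i, gm, d =>
      match computeTree cm fl f [.reg r] i gm k.dir with
      | none => none
      | some tlk =>
          match lkResult k tlk gm i with
          | some gm' => (computeTree cm fl f l i gm' d).map (.lk k tlk)
          | none => some (.lkFail k tlk)
  | f + 1, .reg (.group g r) :: l, i, gm, d =>
      (computeTree cm fl f (.reg r :: .close g :: l) i (gm.openGroup i.idx g) d).map
        (.groupAction (.openGroup g))
  | f + 1, .reg (.anchor a) :: l, i, gm, d =>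
      if AnchorSatisfied cm fl i a then (computeTree cm fl f l i gm d).map (.anchorPass a)
      else some .mismatched
  | f + 1, .reg (.backreference g) :: l, i, gm, d =>
      match readBackref cm fl gm g i d with
      | some (s, i') => (computeTree cm fl f l i' gm d).map (.readBackref s)
      | none => some .mismatched

/-- Semantic states: the arguments of the functional semantics. -/
structure State where
  actions : List Action
  inp : Input
  gm : GroupMap
  dir : Direction

/-- `Next cm fl s₁ s₂`: evaluating the functional semantics at `s₁` makes a recursive call at `s₂`,
that is, `s₂` is one of the next semantic states of `s₁`. -/
inductive Next (cm : CaseMap) (fl : Flags) : State → State → Prop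
  | check {i' l i gm d} (h : Input.Lt d i i') :
      Next cm fl ⟨.check i' :: l, i, gm, d⟩ ⟨l, i, gm, d⟩
  | close {g l i gm d} :
      Next cm fl ⟨.close g :: l, i, gm, d⟩ ⟨l, i, gm.closeGroup i.idx g, d⟩
  | epsilon {l i gm d} :
      Next cm fl ⟨.reg .epsilon :: l, i, gm, d⟩ ⟨l, i, gm, d⟩
  | character {cd l i gm d c i'} (h : readChar cm fl cd i d = some (c, i')) :
      Next cm fl ⟨.reg (.character cd) :: l, i, gm, d⟩ ⟨l, i', gm, d⟩
  | disjunctionLeft {r₁ r₂ l i gm d} :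
      Next cm fl ⟨.reg (.disjunction r₁ r₂) :: l, i, gm, d⟩ ⟨.reg r₁ :: l, i, gm, d⟩
  | disjunctionRight {r₁ r₂ l i gm d} :
      Next cm fl ⟨.reg (.disjunction r₁ r₂) :: l, i, gm, d⟩ ⟨.reg r₂ :: l, i, gm, d⟩
  | sequence {r₁ r₂ l i gm d} :
      Next cm fl ⟨.reg (.sequence r₁ r₂) :: l, i, gm, d⟩ ⟨seqList r₁ r₂ d ++ l, i, gm, d⟩
  | quantifiedForced {greedy min Δ r l i gm d} :
      Next cm fl ⟨.reg (.quantified greedy (min + 1) Δ r) :: l, i, gm, d⟩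
        ⟨.reg r :: .reg (.quantified greedy min Δ r) :: l, i, gm.reset r.defGroups, d⟩
  | quantifiedSkip {greedy Δ r l i gm d} :
      Next cm fl ⟨.reg (.quantified greedy 0 Δ r) :: l, i, gm, d⟩ ⟨l, i, gm, d⟩
  | quantifiedIter {greedy Δ r l i gm d} (h : Δ ≠ 0) :
      Next cm fl ⟨.reg (.quantified greedy 0 Δ r) :: l, i, gm, d⟩
        ⟨.reg r :: .check i :: .reg (.quantified greedy 0 (Δ - 1) r) :: l, i,
          gm.reset r.defGroups, d⟩
  | lookaroundEnter {k r l i gm d} :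
      Next cm fl ⟨.reg (.lookaround k r) :: l, i, gm, d⟩ ⟨[.reg r], i, gm, k.dir⟩
  | lookaroundContinue {k r l i gm d f tlk gm'}
      (h : computeTree cm fl f [.reg r] i gm k.dir = some tlk)
      (h' : lkResult k tlk gm i = some gm') :
      Next cm fl ⟨.reg (.lookaround k r) :: l, i, gm, d⟩ ⟨l, i, gm', d⟩
  | group {g r l i gm d} :
      Next cm fl ⟨.reg (.group g r) :: l, i, gm, d⟩
        ⟨.reg r :: .close g :: l, i, gm.openGroup i.idx g, d⟩
  | anchor {a l i gm d} (h : AnchorSatisfied cm fl i a) :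
      Next cm fl ⟨.reg (.anchor a) :: l, i, gm, d⟩ ⟨l, i, gm, d⟩
  | backreference {g l i gm d s i'} (h : readBackref cm fl gm g i d = some (s, i')) :
      Next cm fl ⟨.reg (.backreference g) :: l, i, gm, d⟩ ⟨l, i', gm, d⟩

/-- The semantic states reachable from the regex `r`: those obtained by finitely many steps from a
state whose only action is to match `r` (at any input, with any group map, in any direction). -/
def Reachable (cm : CaseMap) (fl : Flags) (r : Regex) (s : State) : Prop :=
  ∃ (i : Input) (gm : GroupMap) (d : Direction),
    Relation.ReflTransGen (Next cm fl) ⟨[.reg r], i, gm, d⟩ s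

/-! ## The fuel function -/

def Action.isCheck : Action → Bool
  | .check _ => true
  | _ => false

/-- The action matches a non-lower-bounded quantifier. -/
def Action.isFreeQuantifier : Action → Bool
  | .reg (.quantified _ 0 _ _) => true
  | _ => false

/-- The size `|a|` of an action. -/
def Action.size : Action → ℕ
  | .reg r => r.size
  | .check _ => 1
  | .close _ => 1

/-- The sum of the sizes of the actions of a list. -/
def sumSize (l : List Action) : ℕ := (l.map Action.size).sum

/-- The chunks of a list of actions: the (possibly empty) sublists separated by the checks. -/
def chunks (l : List Action) : List (List Action) := l.splitOnP Action.isCheck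

open Classical in
noncomputable def prog (l : List Action) (i : Input) (d : Direction) : ℕ :=
  if ∀ i', Action.check i' ∈ l → Input.Lt d i i' then 1 else 0

def fuelFirst (c : List Action) (p : ℕ) : ℕ :=
  match c with
  | [] => 0
  | a :: c' => if a.isFreeQuantifier ∧ p = 1 then 1 + sumSize c' else sumSize (a :: c')

def fuelMiddle (c : List Action) : ℕ := 1 + sumSize c.tail

def fuelLast (c : List Action) (i : Input) (d : Direction) (p : ℕ) : ℕ :=
  sumSize c * (i.remaining d + p)

/-- The contribution of all chunks after the first one (all are middle chunks, except for the
last). -/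
def fuelTail (i : Input) (d : Direction) (p : ℕ) : List (List Action) → ℕ
  | [] => 0
  | [c] => fuelLast c i d p
  | c :: cs => (fuelMiddle c + 1) + fuelTail i d p cs

/-- The contribution of the chunks. A single chunk counts as the last one. -/
def fuelChunks (i : Input) (d : Direction) (p : ℕ) : List (List Action) → ℕ
  | [] => 0
  | [c] => fuelLast c i d p
  | c :: cs => (fuelFirst c p + 1) + fuelTail i d p cs

def regLkFuel (s : List Character) : Regex → ℕ
  | .epsilon => 0
  | .character _ => 0
  | .anchor _ => 0
  | .backreference _ => 0
  | .group _ r => regLkFuel s r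
  | .quantified _ _ _ r => regLkFuel s r
  | .disjunction r₁ r₂ => max (regLkFuel s r₁) (regLkFuel s r₂)
  | .sequence r₁ r₂ => max (regLkFuel s r₁) (regLkFuel s r₂)
  | .lookaround _ r => (1 + s.length) * r.size + regLkFuel s r

/-- The maximum of `regLkFuel s r` over the regex actions of the list (`0` if there are none). -/
def actLkFuel (s : List Character) : List Action → ℕ
  | [] => 0
  | .reg r :: l => max (regLkFuel s r) (actLkFuel s l)
  | _ :: l => actLkFuel s l

noncomputable def fuel (s : State) : ℕ :=
  fuelChunks s.inp s.dir (prog s.actions s.inp s.dir) (chunks s.actions)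
    + actLkFuel s.inp.str s.actions

end JSRegex

/-! The fuel is an amortised count. The chunks before the last belong to iterations in progress and
are charged once; the last chunk is charged `|i|_d + p` times, where `p` records that the input is
strictly past every pending check. This factor never grows while the input advances: a strict
advance lowers `|i|_d` by at least one and raises `p` by at most one (`remaining_add_prog_le`).
Hence a step that replaces the first action by actions of smaller total size loses fuel
(`fuel_lt_of_replace`). Three steps need their own argument.

Starting an iteration (`fuel_quantifiedIter_lt`) duplicates the body `r`. The new check is at the
current input, so `p` becomes 0. If `p` was 1, this saves one full charge of the last chunk, which
pays for `r` because that chunk is larger than `r`. If `p` was already 0, the quantifier was charged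
at its full size `|r| + 3`, which covers the body, the separator and the new charge 1 of the
quantifier.

Passing a check (`fuel_check_lt`) saves the 1 charged for the separator. The next chunk starts with
a quantifier, charged 1 in a middle chunk and still 1 in a first chunk with `p = 1`; if it is the
last chunk, its charge is unchanged.

Entering a lookaround (`fuel_lookaroundEnter_lt`) discards the continuation and may reverse the
direction; the lookaround fuel reserves `(1 + |s|) |r|`, enough from any position.

These arguments rest on an invariant of reachable states (`State.Invariant`): each check is followed
by a quantifier whose body is at least as large as any regex before the check, and the inputs of the
checks are ordered, with the current input at or past them. -/

namespace JSRegex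

/-! ## Inputs -/

/-- `i ≤_d i'`: same string, and the position of `i` is at least as far in direction `d`. -/
def Input.Le (d : Direction) (i i' : Input) : Prop :=
  i.str = i'.str ∧ i.remaining d ≤ i'.remaining d

theorem Input.Le.refl (d : Direction) (i : Input) : Input.Le d i i := ⟨rfl, le_rfl⟩

theorem Input.Le.trans {d : Direction} {i j k : Input} (h : Input.Le d i j)
    (h' : Input.Le d j k) : Input.Le d i k :=
  ⟨h.1.trans h'.1, h.2.trans h'.2⟩

theorem Input.length_str (i : Input) : i.str.length = i.behind.length + i.ahead.length := by
  simp [Input.str]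

theorem Input.remaining_le_length_str (i : Input) (d : Direction) :
    i.remaining d ≤ i.str.length := by
  rw [Input.length_str]
  cases d <;> simp [Input.remaining]

/-- In a fixed string the two remaining lengths have constant sum, so comparing positions amounts to
comparing remaining lengths. This treats both directions uniformly. -/
theorem Input.lt_iff {d : Direction} {i i' : Input} :
    Input.Lt d i i' ↔ i.str = i'.str ∧ i.remaining d < i'.remaining d := by
  unfold Input.Lt
  refine and_congr_right fun h => ?_
  have hl := congrArg List.length h
  rw [Input.length_str, Input.length_str] at hl
  cases d <;> simp only [Input.idx, Input.remaining]
  omega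

theorem Input.advance_le (d : Direction) (i : Input) : Input.Le d (i.advance d) i := by
  obtain ⟨b, a⟩ := i
  cases d
  · cases a <;> simp [Input.Le, Input.advance, Input.str, Input.remaining]
  · cases b <;> simp [Input.Le, Input.advance, Input.str, Input.remaining]

theorem Input.advanceN_le (d : Direction) (n : ℕ) (i : Input) :
    Input.Le d (i.advanceN d n) i := by
  induction n generalizing i with
  | zero => exact Input.Le.refl d i
  | succ n ih => exact (ih (i.advance d)).trans (Input.advance_le d i)

theorem readChar_le {cm : CaseMap} {fl : Flags} {cd : CharDescr} {i i' : Input} {d : Direction}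
    {c : Character} (h : readChar cm fl cd i d = some (c, i')) : Input.Le d i' i := by
  obtain ⟨b, a⟩ := i
  cases d
  · cases a with
    | nil => simp [readChar] at h
    | cons x a =>
      simp only [readChar, Option.ite_none_right_eq_some, Option.some.injEq, Prod.mk.injEq] at h
      obtain ⟨-, -, rfl⟩ := h
      simp [Input.Le, Input.str, Input.remaining]
  · cases b with
    | nil => simp [readChar] at h
    | cons x b =>
      simp only [readChar, Option.ite_none_right_eq_some, Option.some.injEq, Prod.mk.injEq] at h
      obtain ⟨-, -, rfl⟩ := h
      simp [Input.Le, Input.str, Input.remaining]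

theorem readBackref_le {cm : CaseMap} {fl : Flags} {gm : GroupMap} {g : ℕ} {i i' : Input}
    {d : Direction} {s : List Character} (h : readBackref cm fl gm g i d = some (s, i')) :
    Input.Le d i' i := by
  unfold readBackref at h
  split at h
  · simp only [Option.ite_none_right_eq_some, Option.some.injEq, Prod.mk.injEq] at h
    obtain ⟨-, -, rfl⟩ := h
    exact Input.advanceN_le _ _ _
  · simp only [Option.some.injEq, Prod.mk.injEq] at h
    obtain ⟨-, rfl⟩ := h
    exact Input.Le.refl _ _

/-! ## The invariant of reachable states -/

/-- Every check of the list is followed by a non-lower-bounded quantifier over a regex of size at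
least `n`. -/
def Guarded (n : ℕ) : List Action → Prop
  | [] => True
  | .check _ :: l =>
      (∃ greedy Δ r l', l = .reg (.quantified greedy 0 Δ r) :: l' ∧ n ≤ r.size) ∧ Guarded n l
  | .reg _ :: l => Guarded n l
  | .close _ :: l => Guarded n l

theorem Guarded.mono {m n : ℕ} (hmn : m ≤ n) : ∀ {l : List Action}, Guarded n l → Guarded m l
  | [], _ => trivial
  | .check _ :: _, ⟨⟨greedy, Δ, r, l', hl, hr⟩, h⟩ =>
      ⟨⟨greedy, Δ, r, l', hl, hmn.trans hr⟩, Guarded.mono hmn h⟩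
  | .reg _ :: l, h => Guarded.mono (l := l) hmn h
  | .close _ :: l, h => Guarded.mono (l := l) hmn h

/-- All checks of the list are at inputs that `i` has reached or passed. -/
def ChecksBehind (d : Direction) (i : Input) (l : List Action) : Prop :=
  ∀ j, Action.check j ∈ l → Input.Le d i j

/-- The action lists that occur in reachable states: no lower-bounded quantifiers, every regex in
front of a check is at most as large as the body of the quantifier after the check, and the inputs
of the checks are ordered. -/
def WellFormed (d : Direction) : List Action → Prop
  | [] => True
  | .check i :: l => Guarded 0 (.check i :: l) ∧ ChecksBehind d i l ∧ WellFormed d l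
  | .reg r :: l => r.NoLowerBound ∧ Guarded r.size l ∧ WellFormed d l
  | .close _ :: l => WellFormed d l

structure State.Invariant (s : State) : Prop where
  wellFormed : WellFormed s.dir s.actions
  checksBehind : ChecksBehind s.dir s.inp s.actions

theorem ChecksBehind.tail {d : Direction} {i : Input} {a : Action} {l : List Action}
    (h : ChecksBehind d i (a :: l)) : ChecksBehind d i l :=
  fun j hj => h j (List.mem_cons_of_mem _ hj)

theorem ChecksBehind.cons {d : Direction} {i : Input} {a : Action} {l : List Action}
    (ha : ∀ j, a = .check j → Input.Le d i j) (h : ChecksBehind d i l) :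
    ChecksBehind d i (a :: l) := by
  intro j hj
  rcases List.mem_cons.1 hj with hj | hj
  · exact ha j hj.symm
  · exact h j hj

theorem ChecksBehind.cons_reg {d : Direction} {i : Input} {r : Regex} {l : List Action}
    (h : ChecksBehind d i l) : ChecksBehind d i (.reg r :: l) :=
  h.cons (by simp)

theorem ChecksBehind.of_le {d : Direction} {i i' : Input} {l : List Action}
    (h : ChecksBehind d i l) (hi : Input.Le d i' i) : ChecksBehind d i' l :=
  fun j hj => hi.trans (h j hj)

theorem invariant_single {r : Regex} (hr : r.NoLowerBound) (i : Input) (gm : GroupMap)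
    (d : Direction) : State.Invariant ⟨[.reg r], i, gm, d⟩ :=
  ⟨⟨hr, trivial, trivial⟩, by simp [ChecksBehind]⟩

/-- Sub-regexes are smaller than the regex they come from, so the guards survive; the input only
advances, so old checks stay behind. The one step that can change the direction, entering a
lookaround, discards all checks. -/
theorem State.Invariant.next {cm : CaseMap} {fl : Flags} {s₁ s₂ : State} (h : s₁.Invariant)
    (hn : Next cm fl s₁ s₂) : s₂.Invariant := by
  obtain ⟨hw, hc⟩ := h
  cases hn with
  | check _ => exact ⟨hw.2.2, hc.tail⟩
  | close => exact ⟨hw, hc.tail⟩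
  | epsilon => exact ⟨hw.2.2, hc.tail⟩
  | character h => exact ⟨hw.2.2, hc.tail.of_le (readChar_le h)⟩
  | disjunctionLeft =>
    obtain ⟨⟨h₁, -⟩, hg, hl⟩ := hw
    exact ⟨⟨h₁, hg.mono (by simp only [Regex.size]; omega), hl⟩, hc.tail.cons_reg⟩
  | disjunctionRight =>
    obtain ⟨⟨-, h₂⟩, hg, hl⟩ := hw
    exact ⟨⟨h₂, hg.mono (by simp only [Regex.size]; omega), hl⟩, hc.tail.cons_reg⟩
  | @sequence r₁ r₂ l i gm d =>
    obtain ⟨⟨h₁, h₂⟩, hg, hl⟩ := hw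
    have hg₁ : Guarded r₁.size l := hg.mono (by simp only [Regex.size]; omega)
    have hg₂ : Guarded r₂.size l := hg.mono (by simp only [Regex.size]; omega)
    cases d
    · exact ⟨⟨h₁, hg₁, h₂, hg₂, hl⟩, hc.tail.cons_reg.cons_reg⟩
    · exact ⟨⟨h₂, hg₂, h₁, hg₁, hl⟩, hc.tail.cons_reg.cons_reg⟩
  | quantifiedForced => exact absurd hw.1.1 (Nat.succ_ne_zero _)
  | quantifiedSkip => exact ⟨hw.2.2, hc.tail⟩
  | @quantifiedIter greedy Δ r l i gm d h =>
    obtain ⟨⟨-, hr⟩, hg, hl⟩ := hw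
    have hgr : Guarded r.size l := hg.mono (by simp only [Regex.size]; omega)
    -- The new check is guarded by the quantifier over `r` itself, so the size bound for `r` holds
    -- with equality.
    refine ⟨⟨hr, ⟨⟨_, _, _, _, rfl, le_rfl⟩, hgr⟩, ⟨⟨_, _, _, _, rfl, Nat.zero_le _⟩,
      Guarded.mono (l := l) (Nat.zero_le _) hgr⟩, hc.tail.cons_reg, ⟨rfl, hr⟩, hg, hl⟩, ?_⟩
    -- The new check sits at the current input: this is why checks are only required to be weakly
    -- behind.
    refine (hc.tail.cons_reg.cons fun j hj => ?_).cons_reg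
    cases hj
    exact Input.Le.refl _ _
  | @lookaroundEnter k r =>
    have hr : r.NoLowerBound := hw.1
    exact invariant_single hr _ _ _
  | lookaroundContinue _ _ => exact ⟨hw.2.2, hc.tail⟩
  | group =>
    obtain ⟨hr, hg, hl⟩ := hw
    exact ⟨⟨hr, Guarded.mono (by simp only [Regex.size]; omega) hg, hl⟩,
      (hc.tail.cons (by simp)).cons_reg⟩
  | anchor _ => exact ⟨hw.2.2, hc.tail⟩
  | backreference h => exact ⟨hw.2.2, hc.tail.of_le (readBackref_le h)⟩

theorem Reachable.invariant {cm : CaseMap} {fl : Flags} {r : Regex} (hr : r.NoLowerBound)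
    {s : State} (h : Reachable cm fl r s) : s.Invariant := by
  obtain ⟨i, gm, d, h⟩ := h
  induction h with
  | refl => exact invariant_single hr i gm d
  | tail _ hn ih => exact ih.next hn

/-! ## Progress -/

theorem prog_le_one (l : List Action) (i : Input) (d : Direction) : prog l i d ≤ 1 := by
  unfold prog
  split <;> omega

theorem prog_congr {l l' : List Action}
    (h : ∀ j, Action.check j ∈ l ↔ Action.check j ∈ l') (i : Input) (d : Direction) :
    prog l i d = prog l' i d := by
  unfold prog
  congr 1
  simp only [h]

theorem prog_eq_zero {l : List Action} {i : Input} {d : Direction} (h : .check i ∈ l) :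
    prog l i d = 0 := by
  unfold prog
  rw [if_neg]
  intro hl
  exact (Input.lt_iff.1 (hl i h)).2.ne rfl

/-- If the input moves strictly, the remaining length drops by at least 1, which absorbs any rise of
the progress bit; otherwise the bit is unchanged. -/
theorem remaining_add_prog_le {d : Direction} {i i' : Input} (h : Input.Le d i' i)
    (l : List Action) :
    i'.remaining d + prog l i' d ≤ i.remaining d + prog l i d := by
  rcases h.2.lt_or_eq with hlt | heq
  · have := prog_le_one l i' d
    omega
  · have : prog l i' d = prog l i d := by
      unfold prog
      congr 1
      simp only [Input.lt_iff, h.1, heq]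
    omega

/-! ## The chunks -/

theorem chunks_nil : chunks [] = [[]] := by simp [chunks]

theorem chunks_cons_of_isCheck {a : Action} (h : a.isCheck = true) (l : List Action) :
    chunks (a :: l) = [] :: chunks l := by
  simp [chunks, List.splitOnP_cons_eq_if_modifyHead, h]

theorem chunks_cons_of_not_isCheck {a : Action} (h : a.isCheck = false) {l c : List Action}
    {cs : List (List Action)} (hl : chunks l = c :: cs) :
    chunks (a :: l) = (a :: c) :: cs := by
  simp only [chunks] at hl
  simp [chunks, List.splitOnP_cons_eq_if_modifyHead, h, hl]

theorem exists_chunks_eq_cons (l : List Action) : ∃ c cs, chunks l = c :: cs :=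
  List.exists_cons_of_ne_nil (List.splitOnP_ne_nil _ _)

theorem not_mem_check_of_chunks_eq_singleton {l c : List Action} (h : chunks l = [c])
    (j : Input) : Action.check j ∉ l := by
  induction l generalizing c with
  | nil => simp
  | cons a l ih =>
    obtain ⟨c', cs, hc⟩ := exists_chunks_eq_cons l
    cases ha : a.isCheck with
    | true => simp [chunks_cons_of_isCheck ha, hc] at h
    | false =>
      rw [chunks_cons_of_not_isCheck ha hc] at h
      obtain ⟨-, rfl⟩ := List.cons.inj h
      intro hm
      rcases List.mem_cons.1 hm with rfl | hm
      · simp [Action.isCheck] at ha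
      · exact ih hc hm

/-- Without checks the progress condition is vacuous. Thus the factor of a sole chunk is positive
even at the end of the string. -/
theorem prog_eq_one_of_chunks_eq_singleton {l c : List Action} (h : chunks l = [c]) (i : Input)
    (d : Direction) : prog l i d = 1 :=
  if_pos fun j hj => absurd hj (not_mem_check_of_chunks_eq_singleton h j)

/-- The last chunk of a guarded list with at least one check is large. -/
theorem Guarded.le_sumSize_getLast {n : ℕ} : ∀ {l : List Action} {c c' : List Action}
    {cs : List (List Action)}, Guarded n l → chunks l = c :: c' :: cs →
      n + 3 ≤ sumSize ((c' :: cs).getLast (List.cons_ne_nil _ _))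
  | [], _, _, _, _, hc => by simp [chunks_nil] at hc
  | .reg r :: l, c, c', cs, h, hc => by
    obtain ⟨d, ds, hd⟩ := exists_chunks_eq_cons l
    rw [chunks_cons_of_not_isCheck rfl hd] at hc
    obtain ⟨-, rfl⟩ := List.cons.inj hc
    exact Guarded.le_sumSize_getLast (l := l) h hd
  | .close g :: l, c, c', cs, h, hc => by
    obtain ⟨d, ds, hd⟩ := exists_chunks_eq_cons l
    rw [chunks_cons_of_not_isCheck rfl hd] at hc
    obtain ⟨-, rfl⟩ := List.cons.inj hc
    exact Guarded.le_sumSize_getLast (l := l) h hd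
  | .check i :: l, c, c', cs, h, hc => by
    obtain ⟨⟨greedy, Δ, r, l', rfl, hr⟩, hg⟩ := h
    rw [chunks_cons_of_isCheck rfl] at hc
    obtain ⟨-, hc⟩ := List.cons.inj hc
    cases cs with
    | cons c'' cs =>
      rw [List.getLast_cons (List.cons_ne_nil _ _)]
      exact Guarded.le_sumSize_getLast hg hc
    -- This is the last check: the last chunk begins with its guarding quantifier, of size `3 +
    -- |r|`, whence the constant 3.
    | nil =>
      obtain ⟨d, ds, hd⟩ := exists_chunks_eq_cons l'
      rw [chunks_cons_of_not_isCheck rfl hd] at hc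
      obtain ⟨rfl, -⟩ := List.cons.inj hc
      simp only [List.getLast_singleton, sumSize, List.map_cons, List.sum_cons, Action.size,
        Regex.size]
      omega

/-! ## The contributions of the chunks to the fuel -/

theorem Regex.size_pos (r : Regex) : 0 < r.size := by
  cases r <;> simp only [Regex.size] <;> omega

theorem sumSize_cons (a : Action) (l : List Action) : sumSize (a :: l) = a.size + sumSize l := by
  simp [sumSize]

theorem fuelFirst_le_sumSize (c : List Action) (p : ℕ) : fuelFirst c p ≤ sumSize c := by
  cases c with
  | nil => simp [fuelFirst]
  | cons a c =>
    simp only [fuelFirst]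
    split
    · rw [sumSize_cons]
      cases a with
      | reg r => have := r.size_pos; simp only [Action.size]; omega
      | check i => simp only [Action.size]; omega
      | close g => simp only [Action.size]; omega
    · exact le_rfl

theorem fuelFirst_of_not_isFreeQuantifier {a : Action} (h : a.isFreeQuantifier = false)
    (c : List Action) (p : ℕ) : fuelFirst (a :: c) p = sumSize (a :: c) := by
  simp [fuelFirst, h]

/-- Even at the reduced rate the quantifier is charged 1, which pays for skipping it. -/
theorem sumSize_lt_fuelFirst_quantified (greedy : Bool) (Δ : ℕ∞) (r : Regex) (c : List Action)
    (p : ℕ) : sumSize c < fuelFirst (.reg (.quantified greedy 0 Δ r) :: c) p := by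
  simp only [fuelFirst]
  split
  · omega
  · simp only [sumSize_cons, Action.size, Regex.size]
    omega

/-- Input and progress bit enter only through the factor of the last chunk. -/
theorem fuelTail_mono {i i' : Input} {d : Direction} {p p' : ℕ}
    (h : i'.remaining d + p' ≤ i.remaining d + p) :
    ∀ cs : List (List Action), fuelTail i' d p' cs ≤ fuelTail i d p cs
  | [] => le_rfl
  | [_] => Nat.mul_le_mul_left _ h
  | _ :: c' :: cs => Nat.add_le_add_left (fuelTail_mono h (c' :: cs)) _

/-- Lowering the progress bit saves the size of the last chunk. -/
theorem fuelTail_add_sumSize_getLast (i : Input) (d : Direction) :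
    ∀ (c : List Action) (cs : List (List Action)),
      fuelTail i d 0 (c :: cs) + sumSize ((c :: cs).getLast (List.cons_ne_nil _ _)) =
        fuelTail i d 1 (c :: cs)
  | _, [] => by
    simp only [fuelTail, fuelLast, List.getLast_singleton]
    ring
  | _, c' :: cs => by
    have := fuelTail_add_sumSize_getLast i d c' cs
    rw [List.getLast_cons (List.cons_ne_nil _ _)]
    simp only [fuelTail] at this ⊢
    omega

/-- Replacing the first chunk by a smaller one decreases the fuel, if the input does not move
back. -/
theorem fuelChunks_lt {i i' : Input} {d : Direction} {p p' : ℕ} {c c' : List Action}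
    {cs : List (List Action)} (h : i'.remaining d + p' ≤ i.remaining d + p)
    (hp : cs = [] → p = 1) (hs : sumSize c' < sumSize c) (hf : sumSize c' < fuelFirst c p) :
    fuelChunks i' d p' (c' :: cs) < fuelChunks i d p (c :: cs) := by
  cases cs with
  | nil =>
    -- With a single chunk strictness comes from its size, so the factor `|i|_d + p` must be
    -- positive.
    obtain rfl := hp rfl
    exact (Nat.mul_le_mul_left _ h).trans_lt (Nat.mul_lt_mul_of_pos_right hs (Nat.succ_pos _))
  -- Whatever `p'` is, the new first chunk is charged at most its full size.
  | cons b cs =>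
    have h₁ := fuelFirst_le_sumSize c' p'
    have h₂ := fuelTail_mono h (b :: cs)
    simp only [fuelChunks]
    omega

/-! ### Fuel decrease for each kind of step. -/

theorem chunks_append {pre l c : List Action} {cs : List (List Action)}
    (h : ∀ a ∈ pre, a.isCheck = false) (hl : chunks l = c :: cs) :
    chunks (pre ++ l) = (pre ++ c) :: cs := by
  induction pre with
  | nil => exact hl
  | cons a pre ih =>
    exact chunks_cons_of_not_isCheck (h a List.mem_cons_self)
      (ih fun b hb => h b (List.mem_cons_of_mem _ hb))

/-- Replacing the first action by smaller actions, none of them a check, decreases the fuel, if the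
input does not move back. -/
theorem fuel_lt_of_replace {a : Action} {pre l : List Action} {i i' : Input}
    {gm gm' : GroupMap} {d : Direction} (ha : a.isCheck = false)
    (hpre : ∀ b ∈ pre, b.isCheck = false) (hi : Input.Le d i' i)
    (hlk : actLkFuel i.str (pre ++ l) ≤ actLkFuel i.str (a :: l))
    (hs : sumSize pre < a.size) (hq : a.isFreeQuantifier = true → pre = []) :
    fuel ⟨pre ++ l, i', gm', d⟩ < fuel ⟨a :: l, i, gm, d⟩ := by
  obtain ⟨c, cs, hc⟩ := exists_chunks_eq_cons l
  have hc₁ := chunks_cons_of_not_isCheck ha hc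
  have hp : prog (pre ++ l) i' d = prog (a :: l) i' d := by
    refine prog_congr (fun j => ?_) _ _
    have h₁ : Action.check j ∉ pre := fun hj => by simpa [Action.isCheck] using hpre _ hj
    have h₂ : Action.check j ≠ a := by rintro rfl; simp [Action.isCheck] at ha
    simp [h₁, h₂]
  have hsum : sumSize (pre ++ c) < sumSize (a :: c) := by
    rw [sumSize_cons]
    simp only [sumSize, List.map_append, List.sum_append] at hs ⊢
    omega
  unfold fuel
  simp only [chunks_append hpre hc, hc₁, hi.1, hp]
  refine Nat.add_lt_add_of_lt_of_le (fuelChunks_lt (remaining_add_prog_le hi _) ?_ hsum ?_) hlk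
  · rintro rfl
    exact prog_eq_one_of_chunks_eq_singleton hc₁ _ _
  -- A quantifier may be charged only 1 here, which pays for its removal but not for a replacement;
  -- hence `hq`.
  · cases hb : a.isFreeQuantifier with
    | false => rwa [fuelFirst_of_not_isFreeQuantifier hb]
    | true =>
      obtain rfl := hq hb
      match a, hb with
      | .reg (.quantified greedy 0 Δ r), _ => exact sumSize_lt_fuelFirst_quantified _ _ _ _ _

theorem fuel_check_lt {i i' : Input} {l : List Action} {gm gm' : GroupMap} {d : Direction}
    (hw : WellFormed d (.check i' :: l)) (h : Input.Lt d i i') :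
    fuel ⟨l, i, gm', d⟩ < fuel ⟨.check i' :: l, i, gm, d⟩ := by
  obtain ⟨⟨⟨greedy, Δ, r, l', rfl, -⟩, -⟩, hb, -⟩ := hw
  obtain ⟨c, cs, hc⟩ := exists_chunks_eq_cons l'
  have hc := chunks_cons_of_not_isCheck (a := .reg (.quantified greedy 0 Δ r)) rfl hc
  rw [Input.lt_iff] at h
  -- The checks are ordered: being strictly past the first one implies being strictly past all, so
  -- the progress bit is 1 before and after the step.
  have hlt : ∀ j, Action.check j ∈ Action.reg (.quantified greedy 0 Δ r) :: l' →
      Input.Lt d i j := fun j hj =>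
    Input.lt_iff.2 ⟨h.1.trans (hb j hj).1, h.2.trans_le (hb j hj).2⟩
  have hp : prog (.reg (.quantified greedy 0 Δ r) :: l') i d = 1 := if_pos hlt
  have hp' : prog (.check i' :: .reg (.quantified greedy 0 Δ r) :: l') i d = 1 := by
    refine if_pos fun j hj => ?_
    rcases List.mem_cons.1 hj with hj | hj
    · cases hj
      exact Input.lt_iff.2 h
    · exact hlt j hj
  unfold fuel
  simp only [chunks_cons_of_isCheck (a := .check i') rfl, hc, hp, hp', actLkFuel]
  cases cs with
  | nil => simp only [fuelChunks, fuelTail, fuelFirst]; omega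
  | cons b cs =>
    -- As first chunk with progress bit 1 and as middle chunk, the chunk has the same charge; only
    -- the separator is saved.
    simp [fuelChunks, fuelTail, fuelFirst, fuelMiddle, Action.isFreeQuantifier]

theorem fuel_quantifiedIter_lt {greedy : Bool} {Δ Δ' : ℕ∞} {r : Regex} {l : List Action}
    {i : Input} {gm gm' : GroupMap} {d : Direction}
    (hg : Guarded (Regex.quantified greedy 0 Δ r).size l) :
    fuel ⟨.reg r :: .check i :: .reg (.quantified greedy 0 Δ' r) :: l, i, gm', d⟩ <
      fuel ⟨.reg (.quantified greedy 0 Δ r) :: l, i, gm, d⟩ := by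
  obtain ⟨c, cs, hc⟩ := exists_chunks_eq_cons l
  have hc₁ := chunks_cons_of_not_isCheck (a := .reg (.quantified greedy 0 Δ r)) rfl hc
  have hc₂ := chunks_cons_of_not_isCheck (a := .reg (.quantified greedy 0 Δ' r)) rfl hc
  have hc₃ : chunks (.reg r :: .check i :: .reg (.quantified greedy 0 Δ' r) :: l) =
      [.reg r] :: (.reg (.quantified greedy 0 Δ' r) :: c) :: cs := by
    refine chunks_cons_of_not_isCheck rfl ?_
    rw [chunks_cons_of_isCheck rfl, hc₂]
  have hp₃ : prog (.reg r :: .check i :: .reg (.quantified greedy 0 Δ' r) :: l) i d = 0 :=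
    prog_eq_zero (by simp)
  have hlk : actLkFuel i.str (.reg r :: .check i :: .reg (.quantified greedy 0 Δ' r) :: l) =
      actLkFuel i.str (.reg (.quantified greedy 0 Δ r) :: l) := by
    simp [actLkFuel, regLkFuel]
  have hfirst : fuelFirst [.reg r] 0 = r.size := by
    simp [fuelFirst, sumSize, Action.size]
  unfold fuel
  simp only [hc₁, hc₃, hp₃, hlk]
  refine Nat.add_lt_add_right ?_ _
  cases cs with
  | nil =>
    -- With `A = 3 + |r| + |c|`, the chunk fuel goes from `A (|i|_d + 1)` to `(|r| + 1) + A |i|_d`.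
    rw [prog_eq_one_of_chunks_eq_singleton hc₁]
    simp only [fuelChunks, fuelTail, fuelLast, hfirst, sumSize_cons, Action.size, Regex.size,
      Nat.mul_add, Nat.mul_one, Nat.add_zero]
    omega
  | cons b cs =>
    have hlast := hg.le_sumSize_getLast hc
    have htail := fuelTail_add_sumSize_getLast i d b cs
    simp only [Regex.size] at hlast
    simp only [fuelChunks, fuelTail, hfirst, fuelMiddle, List.tail_cons]
    rcases Nat.le_one_iff_eq_zero_or_eq_one.1
      (prog_le_one (.reg (.quantified greedy 0 Δ r) :: l) i d) with hp | hp
    -- The decrease is exactly 1: `(3 + |r| + |c|) + 1` becomes `(|r| + 1) + (1 + |c| + 1)`, with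
    -- the same tail.
    · rw [hp]
      simp only [fuelFirst, Nat.zero_ne_one, and_false, if_false, sumSize_cons, Action.size,
        Regex.size]
      omega
    -- The first chunks now cost `|r| + 1` more, and the lowered bit saves the last chunk, of size
    -- at least `|r| + 6`.
    · rw [hp]
      simp only [fuelFirst, Action.isFreeQuantifier, and_self, if_true]
      omega

theorem fuel_lookaroundEnter_lt {k : Lookaround} {r : Regex} {l : List Action} {i : Input}
    {gm gm' : GroupMap} {d d' : Direction} :
    fuel ⟨[.reg r], i, gm', d'⟩ < fuel ⟨.reg (.lookaround k r) :: l, i, gm, d⟩ := by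
  obtain ⟨c, cs, hc⟩ := exists_chunks_eq_cons l
  have hc₁ := chunks_cons_of_not_isCheck (a := .reg (.lookaround k r)) rfl hc
  have hc₂ : chunks [.reg r] = [[.reg r]] := chunks_cons_of_not_isCheck rfl chunks_nil
  -- The reserved lookaround fuel gives only a weak inequality; strictness comes from the chunks.
  have hpos : 0 < fuelChunks i d (prog (.reg (.lookaround k r) :: l) i d)
      ((.reg (.lookaround k r) :: c) :: cs) := by
    cases cs with
    | nil =>
      rw [prog_eq_one_of_chunks_eq_singleton hc₁]
      simp only [fuelChunks, fuelLast, sumSize_cons, Action.size, Regex.size]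
      positivity
    | cons b cs => simp only [fuelChunks]; omega
  have hle : r.size * (i.remaining d' + 1) ≤ (1 + i.str.length) * r.size := by
    rw [Nat.mul_comm, Nat.add_comm 1]
    exact Nat.mul_le_mul_right _ (Nat.succ_le_succ (i.remaining_le_length_str d'))
  have hmax := le_max_left ((1 + i.str.length) * r.size + regLkFuel i.str r) (actLkFuel i.str l)
  unfold fuel
  simp only [hc₁, hc₂, prog_eq_one_of_chunks_eq_singleton hc₂]
  have he : fuelChunks i d' 1 [[.reg r]] = r.size * (i.remaining d' + 1) := by
    simp [fuelChunks, fuelLast, sumSize, Action.size]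
  rw [he]
  simp only [actLkFuel, regLkFuel, Nat.max_zero]
  omega

theorem State.Invariant.fuel_lt {cm : CaseMap} {fl : Flags} {s₁ s₂ : State} (h : s₁.Invariant)
    (hn : Next cm fl s₁ s₂) : fuel s₂ < fuel s₁ := by
  have hw := h.wellFormed
  cases hn with
  | check h' => exact fuel_check_lt hw h'
  | close =>
    exact fuel_lt_of_replace (pre := []) rfl (by simp) (Input.Le.refl _ _) le_rfl
      (by simp [sumSize, Action.size]) (by simp)
  | epsilon =>
    exact fuel_lt_of_replace (pre := []) rfl (by simp) (Input.Le.refl _ _)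
      (le_max_right _ _) (by simp [sumSize, Action.size, Regex.size]) (by simp)
  | character h' =>
    exact fuel_lt_of_replace (pre := []) rfl (by simp) (readChar_le h')
      (le_max_right _ _) (by simp [sumSize, Action.size, Regex.size]) (by simp)
  | @disjunctionLeft r₁ r₂ =>
    exact fuel_lt_of_replace (pre := [.reg r₁]) rfl (by simp [Action.isCheck])
      (Input.Le.refl _ _) (max_le_max (le_max_left _ _) le_rfl)
      (by simp only [sumSize, Action.size, Regex.size, List.map_cons, List.map_nil,
            List.sum_cons, List.sum_nil]; omega) (by simp [Action.isFreeQuantifier])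
  | @disjunctionRight r₁ r₂ =>
    exact fuel_lt_of_replace (pre := [.reg r₂]) rfl (by simp [Action.isCheck])
      (Input.Le.refl _ _) (max_le_max (le_max_right _ _) le_rfl)
      (by simp only [sumSize, Action.size, Regex.size, List.map_cons, List.map_nil,
            List.sum_cons, List.sum_nil]; omega) (by simp [Action.isFreeQuantifier])
  | @sequence r₁ r₂ l i gm d =>
    refine fuel_lt_of_replace (pre := seqList r₁ r₂ d) rfl ?_ (Input.Le.refl _ _) ?_ ?_
      (by simp [Action.isFreeQuantifier])
    · cases d <;> simp [seqList, Action.isCheck]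
    · cases d <;> simp only [seqList, List.cons_append, List.nil_append, actLkFuel, regLkFuel] <;>
        omega
    · cases d <;> simp only [seqList, sumSize, Action.size, Regex.size, List.map_cons,
        List.map_nil, List.sum_cons, List.sum_nil] <;> omega
  -- A forced iteration needs a positive lower bound, which the invariant excludes.
  | quantifiedForced => exact absurd hw.1.1 (Nat.succ_ne_zero _)
  | quantifiedSkip =>
    exact fuel_lt_of_replace (pre := []) rfl (by simp) (Input.Le.refl _ _)
      (le_max_right _ _) (by simp [sumSize, Action.size, Regex.size]) (by simp)
  | quantifiedIter _ => exact fuel_quantifiedIter_lt hw.2.1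
  | lookaroundEnter => exact fuel_lookaroundEnter_lt
  | lookaroundContinue _ _ =>
    exact fuel_lt_of_replace (pre := []) rfl (by simp) (Input.Le.refl _ _)
      (le_max_right _ _) (by simp [sumSize, Action.size, Regex.size]) (by simp)
  | @group g r =>
    exact fuel_lt_of_replace (pre := [.reg r, .close g]) rfl (by simp [Action.isCheck])
      (Input.Le.refl _ _) le_rfl
      (by simp only [sumSize, Action.size, Regex.size, List.map_cons, List.map_nil,
            List.sum_cons, List.sum_nil]; omega) (by simp [Action.isFreeQuantifier])
  | anchor _ =>
    exact fuel_lt_of_replace (pre := []) rfl (by simp) (Input.Le.refl _ _)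
      (le_max_right _ _) (by simp [sumSize, Action.size, Regex.size]) (by simp)
  | backreference h' =>
    exact fuel_lt_of_replace (pre := []) rfl (by simp) (readBackref_le h')
      (le_max_right _ _) (by simp [sumSize, Action.size, Regex.size]) (by simp)

end JSRegex

theorem mainTheorem8 (cm : JSRegex.CaseMap) (fl : JSRegex.Flags) (r : JSRegex.Regex)
    (hr : r.NoLowerBound) (s₁ s₂ : JSRegex.State) (h₁ : JSRegex.Reachable cm fl r s₁)
    (h₂ : JSRegex.Next cm fl s₁ s₂) :
    JSRegex.fuel s₂ < JSRegex.fuel s₁ :=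
  (h₁.invariant hr).fuel_lt h₂
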